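/- **Game.** Let $\mathcal V_1,\mathcal V_2$ be nonempty finite sets of agents, $n_l=|\mathcal V_l|$, and let $\mathcal A_1,\mathcal A_2$ be nonempty finite sets of pure actions, $M_l=|\mathcal A_l|$, with mixed strategy sets $\mathcal X_l=\Delta(\mathcal A_l)\subset\mathbb R^{M_l}$. Each agent $i\in\mathcal V_l$ has real costs $f_{l,i}(p,q)$, $(p,q)\in\mathcal A_1\times\mathcal A_2$, extended to mixed strategies by $f_{l,i}(x_1,x_2)=\sum_{p,q}x_1^{(p)}x_2^{(q)}f_{l,i}(p,q)$. Put $f_l=\frac1{n_l}\sum_{i\in\mathcal V_l}f_{l,i}$ and $U=f_1$, and assume $f_1+f_2=0$ on $\mathcal X_1\times\mathcal X_2$. A mixed-strategy Nash equilibrium is a pair $(x_1^*,x_2^*)\in\mathcal X_1\times\mathcal X_2$ such that $x_1^*$ minimizes $U(\cdot,x_2^*)$ over $\mathcal X_1$ and $x_2^*$ maximizes $U(x_1^*,\cdot)$ over $\mathcal X_2$. Let $\mathcal X^*$ be the set of these pairs. **Communication.** At each time $k=0,1,2,\dots$ there are a digraph $\mathcal G_l(k)$ on $\mathcal V_l$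 ($l=1,2$) and a bipartite digraph $\mathcal G_{12}(k)$ between $\mathcal V_1$ and $\mathcal V_2$; an edge $(j,i)$ means that $i$ receives information from $j$, and then $j$ is called a neighbor of $i$. Let $\mathcal N_l^i(k)$ be the set of neighbors of $i\in\mathcal V_l$ in $\mathcal G_l(k)$ and $\mathcal N_{12,l}^i(k)\subset\mathcal V_{3-l}$ its set of neighbors in $\mathcal G_{12}(k)$. The graphs carry real weights $w_{l,ij}(k)$ and $w_{12,ij}(k)$ on the edges $(j,i)$. Assume, for $l=1,2$: - there is a positive integer $B_l$ such that $\bigcup_{t=k}^{k+B_l-1}\mathcal G_l(t)$ is strongly connected for every $k\ge0$; every agent is its own neighbor, $i\in\mathcal N_l^i(k)$ for all $k$; and $\mathcal N_{12,l}^i(k)\neq\emptyset$ for all $i\in\mathcal V_l$ and $k$; - there is $\eta\in(0,1)$ with $w_{l,ij}(k)\ge\eta$ if $j\in\mathcal N_l^i(k)$ and $w_{l,ij}(k)=0$ otherwise, and likewise for the weights $w_{12,ij}(k)$ of $\mathcal G_{12}(k)$; - $\sum_{j\in\mathcal V_l}w_{l,ij}(k)=\sum_{i\in\mathcal V_l}w_{l,ij}(k)=1$,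 and $\sum_{j\in\mathcal V_{3-l}}w_{12,ij}(k)=1$ for $i\in\mathcal V_l$. **Algorithm (distributed multiplicative weights).** Let $\alpha(t)>0$, $t\ge0$, be non-increasing with $\sum_t\alpha(t)=\infty$ and $\sum_t\alpha(t)^2<\infty$. Start from $x_{l,i}(0)=\frac1{M_l}(1,\dots,1)$. At time $t$ each $i\in\mathcal V_l$ forms $v_{l,i}(t)=\sum_{j\in\mathcal N_l^i(t)}w_{l,ij}(t)x_{l,j}(t)$ and $u_{3-l,i}(t)=\sum_{j\in\mathcal N_{12,l}^i(t)}w_{12,ij}(t)x_{3-l,j}(t)$, then the vector $g_{l,i}(t)$ given by $g_{1,i}^{(p)}(t)=f_{1,i}(p,u_{2,i}(t))$ for $p\in\mathcal A_1$ if $l=1$, and $g_{2,i}^{(q)}(t)=f_{2,i}(u_{1,i}(t),q)$ for $q\in\mathcal A_2$ if $l=2$, and sets $$x_{l,i}^{(p)}(t+1)=\frac{v_{l,i}^{(p)}(t)\exp(-\alpha(t)g_{l,i}^{(p)}(t))}{\sum_{k}v_{l,i}^{(k)}(t)\exp(-\alpha(t)g_{l,i}^{(k)}(t))},\qquad p\in\mathcal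 A_l .$$ For $t\ge1$ let $\hat x_{l,i}(t)=\big(\sum_{s=0}^{t-1}\alpha(s)\big)^{-1}\sum_{s=0}^{t-1}\alpha(s)x_{l,i}(s)$. **Theorem.** The set $\mathcal X^*$ is nonempty and, for all $i\in\mathcal V_1$ and $j\in\mathcal V_2$, as $t\to\infty$, the duality gap tends to zero, $$\max_{x_2\in\mathcal X_2}U(\hat x_{1,i}(t),x_2)-\min_{x_1\in\mathcal X_1}U(x_1,\hat x_{2,j}(t))\to0,$$ and the averages converge to the set of mixed-strategy Nash equilibria, $\operatorname{dist}\big((\hat x_{1,i}(t),\hat x_{2,j}(t)),\mathcal X^*\big)\to0$. -/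

import Mathlib

open Filter Topology
open scoped Classical

noncomputable section

namespace SubnetworkGame

/-! Games between two subnetworks of agents with finitely many pure actions -/

/-- The pure-action costs of the agents of two subnetworks: `cost₁ i p q` and `cost₂ j p q` are the
costs of agent `i` of the first and agent `j` of the second subnetwork at the pure profile
`(p, q)`. -/
structure FiniteGame (V₁ V₂ A₁ A₂ : Type*) where
  cost₁ : V₁ → A₁ → A₂ → ℝ
  cost₂ : V₂ → A₁ → A₂ → ℝ

/-- Expected value of the pure-action cost `c` at a profile of mixed strategies. -/
def expCost {A₁ A₂ : Type*} [Fintype A₁] [Fintype A₂] (c : A₁ → A₂ → ℝ)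
    (x₁ : A₁ → ℝ) (x₂ : A₂ → ℝ) : ℝ :=
  ∑ p, ∑ q, x₁ p * x₂ q * c p q

/-- The mixed strategy that plays the pure action `a` with probability one. -/
def pureStrategy {A : Type*} (a : A) : A → ℝ := fun b => if b = a then 1 else 0

namespace FiniteGame

variable {V₁ V₂ A₁ A₂ : Type*} [Fintype V₁] [Fintype V₂] [Fintype A₁] [Fintype A₂]

/-- Global cost of the first subnetwork: the average of the expected costs of its agents. -/
def globalCost₁ (Γ : FiniteGame V₁ V₂ A₁ A₂) (x₁ : A₁ → ℝ) (x₂ : A₂ → ℝ) : ℝ :=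
  (1 / (Fintype.card V₁ : ℝ)) * ∑ i, expCost (Γ.cost₁ i) x₁ x₂

/-- Global cost of the second subnetwork. -/
def globalCost₂ (Γ : FiniteGame V₁ V₂ A₁ A₂) (x₁ : A₁ → ℝ) (x₂ : A₂ → ℝ) : ℝ :=
  (1 / (Fintype.card V₂ : ℝ)) * ∑ j, expCost (Γ.cost₂ j) x₁ x₂

/-- The subnetworks play a zero-sum game: their global costs add up to zero. The costs of
individual agents need not be related. -/
def IsZeroSum (Γ : FiniteGame V₁ V₂ A₁ A₂) : Prop :=
  ∀ x₁ ∈ stdSimplex ℝ A₁, ∀ x₂ ∈ stdSimplex ℝ A₂,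
    Γ.globalCost₁ x₁ x₂ + Γ.globalCost₂ x₁ x₂ = 0

/-- The set of mixed-strategy Nash equilibria: the first subnetwork minimizes and the second one
maximizes the global cost of the first. -/
def mixedNash (Γ : FiniteGame V₁ V₂ A₁ A₂) : Set ((A₁ → ℝ) × (A₂ → ℝ)) :=
  {x | x.1 ∈ stdSimplex ℝ A₁ ∧ x.2 ∈ stdSimplex ℝ A₂ ∧
    IsMinOn (fun y₁ => Γ.globalCost₁ y₁ x.2) (stdSimplex ℝ A₁) x.1 ∧
    IsMaxOn (fun y₂ => Γ.globalCost₁ x.1 y₂) (stdSimplex ℝ A₂) x.2}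

/-- The duality gap of a profile of mixed strategies: the maximum of the cost over the strategies
of the second subnetwork minus its minimum over the strategies of the first one. -/
def dualityGap (Γ : FiniteGame V₁ V₂ A₁ A₂) (x₁ : A₁ → ℝ) (x₂ : A₂ → ℝ) : ℝ :=
  (⨆ y₂ : stdSimplex ℝ A₂, Γ.globalCost₁ x₁ y₂) - ⨅ y₁ : stdSimplex ℝ A₁, Γ.globalCost₁ y₁ x₂

end FiniteGame

/-! Communication networks -/

/-- Time-varying communication networks: digraphs inside each of the two subnetworks, a digraph
between them, and a matrix of weights for each of these. An edge from `j` to `i` means that `i`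
obtains information from `j`; its weight is the `(i, j)` entry of the matrix. -/
structure Network (V₁ V₂ : Type*) where
  graph₁ : ℕ → Digraph V₁
  graph₂ : ℕ → Digraph V₂
  graph₁₂ : ℕ → Digraph (V₁ ⊕ V₂)
  weight₁ : ℕ → Matrix V₁ V₁ ℝ
  weight₂ : ℕ → Matrix V₂ V₂ ℝ
  weight₁₂ : ℕ → Matrix (V₁ ⊕ V₂) (V₁ ⊕ V₂) ℝ

/-- There is a directed path between any ordered pair of distinct nodes. -/
def StronglyConnected {V : Type*} (G : Digraph V) : Prop :=
  ∀ i j, i ≠ j → Relation.ReflTransGen G.Adj i j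

/-- For some positive `B`, the union of the graphs over every time window of length `B` is strongly
connected. -/
def UniformlyJointlyStronglyConnected {V : Type*} (G : ℕ → Digraph V) : Prop :=
  ∃ B : ℕ, 0 < B ∧ ∀ k, StronglyConnected (⨆ t ∈ Set.Ico k (k + B), G t)

/-- Weights are at least `η` along the edges of the graph, and zero elsewhere. -/
def WeightsCompatible {V : Type*} (η : ℝ) (G : Digraph V) (W : Matrix V V ℝ) : Prop :=
  ∀ i j, (G.Adj j i → η ≤ W i j) ∧ (¬ G.Adj j i → W i j = 0)

/-- The assumptions on the communication networks. -/
structure Network.Admissible {V₁ V₂ : Type*} [Fintype V₁] [Fintype V₂] (N : Network V₁ V₂) :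
    Prop where
  /-- The graph between the subnetworks is bipartite. -/
  bipartite : ∀ k,
    (∀ i j, ¬ (N.graph₁₂ k).Adj (Sum.inl i) (Sum.inl j)) ∧
    (∀ i j, ¬ (N.graph₁₂ k).Adj (Sum.inr i) (Sum.inr j))
  connected₁ : UniformlyJointlyStronglyConnected N.graph₁
  connected₂ : UniformlyJointlyStronglyConnected N.graph₂
  /-- Every agent has access to its own estimate. -/
  self₁ : ∀ k i, (N.graph₁ k).Adj i i
  self₂ : ∀ k i, (N.graph₂ k).Adj i i
  /-- Every agent has a neighbor in the other subnetwork. -/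
  neighbor₁ : ∀ k i, ∃ j, (N.graph₁₂ k).Adj (Sum.inr j) (Sum.inl i)
  neighbor₂ : ∀ k j, ∃ i, (N.graph₁₂ k).Adj (Sum.inl i) (Sum.inr j)
  weights : ∃ η : ℝ, 0 < η ∧ η < 1 ∧ ∀ k,
    WeightsCompatible η (N.graph₁ k) (N.weight₁ k) ∧
    WeightsCompatible η (N.graph₂ k) (N.weight₂ k) ∧
    WeightsCompatible η (N.graph₁₂ k) (N.weight₁₂ k)
  rowSum₁ : ∀ k i, ∑ j, N.weight₁ k i j = 1
  colSum₁ : ∀ k j, ∑ i, N.weight₁ k i j = 1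
  rowSum₂ : ∀ k i, ∑ j, N.weight₂ k i j = 1
  colSum₂ : ∀ k j, ∑ i, N.weight₂ k i j = 1
  crossSum₁ : ∀ k i, ∑ j, N.weight₁₂ k (Sum.inl i) (Sum.inr j) = 1
  crossSum₂ : ∀ k j, ∑ i, N.weight₁₂ k (Sum.inr j) (Sum.inl i) = 1

/-! The distributed multiplicative-weight algorithm -/

/-- One multiplicative-weight update, from the weighted average `v` along the gradient `g` with
step-size `a`. -/
def mwUpdate {A : Type*} [Fintype A] (a : ℝ) (v g : A → ℝ) : A → ℝ := fun p =>
  v p * Real.exp (-a * g p) / ∑ k, v k * Real.exp (-a * g k)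

section Algorithm

variable {V₁ V₂ A₁ A₂ : Type*} [Fintype V₁] [Fintype V₂] [Fintype A₁] [Fintype A₂]

/-- The estimates of all agents of the two subnetworks. -/
abbrev Estimates (V₁ V₂ A₁ A₂ : Type*) := (V₁ → A₁ → ℝ) × (V₂ → A₂ → ℝ)

/-- The average of its own subnetwork's estimates formed by agent `i` of the first subnetwork. -/
def avg₁ (N : Network V₁ V₂) (t : ℕ) (x : Estimates V₁ V₂ A₁ A₂) (i : V₁) : A₁ → ℝ :=
  ∑ j with (N.graph₁ t).Adj j i, N.weight₁ t i j • x.1 j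

/-- The average of its own subnetwork's estimates formed by agent `i` of the second subnetwork. -/
def avg₂ (N : Network V₁ V₂) (t : ℕ) (x : Estimates V₁ V₂ A₁ A₂) (i : V₂) : A₂ → ℝ :=
  ∑ j with (N.graph₂ t).Adj j i, N.weight₂ t i j • x.2 j

/-- The estimate of the second subnetwork's action formed by agent `i` of the first one. -/
def cross₂ (N : Network V₁ V₂) (t : ℕ) (x : Estimates V₁ V₂ A₁ A₂) (i : V₁) : A₂ → ℝ :=
  ∑ j with (N.graph₁₂ t).Adj (Sum.inr j) (Sum.inl i), N.weight₁₂ t (Sum.inl i) (Sum.inr j) • x.2 j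

/-- The estimate of the first subnetwork's action formed by agent `i` of the second one. -/
def cross₁ (N : Network V₁ V₂) (t : ℕ) (x : Estimates V₁ V₂ A₁ A₂) (i : V₂) : A₁ → ℝ :=
  ∑ j with (N.graph₁₂ t).Adj (Sum.inl j) (Sum.inr i), N.weight₁₂ t (Sum.inr i) (Sum.inl j) • x.1 j

/-- One round of the algorithm at time `t` with step-size `a`. -/
def mwStep (Γ : FiniteGame V₁ V₂ A₁ A₂) (N : Network V₁ V₂) (a : ℝ) (t : ℕ)
    (x : Estimates V₁ V₂ A₁ A₂) : Estimates V₁ V₂ A₁ A₂ :=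
  (fun i => mwUpdate a (avg₁ N t x i)
      (fun p => expCost (Γ.cost₁ i) (pureStrategy p) (cross₂ N t x i)),
   fun i => mwUpdate a (avg₂ N t x i)
      (fun q => expCost (Γ.cost₂ i) (cross₁ N t x i) (pureStrategy q)))

/-- The iterates of the distributed multiplicative-weight algorithm, started at the uniform
strategies. -/
def mwIterates (Γ : FiniteGame V₁ V₂ A₁ A₂) (N : Network V₁ V₂) (α : ℕ → ℝ) :
    ℕ → Estimates V₁ V₂ A₁ A₂
  | 0 => (fun _ _ => 1 / (Fintype.card A₁ : ℝ), fun _ _ => 1 / (Fintype.card A₂ : ℝ))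
  | t + 1 => mwStep Γ N (α t) t (mwIterates Γ N α t)

end Algorithm

/-- The average of `x 0, …, x (t - 1)` weighted by the step-sizes (meaningful for `1 ≤ t`). -/
def ergodicAverage {A : Type*} (α : ℕ → ℝ) (x : ℕ → A → ℝ) (t : ℕ) : A → ℝ :=
  (1 / ∑ s ∈ Finset.range t, α s) • ∑ s ∈ Finset.range t, α s • x s

end SubnetworkGame

end

/-! Each subnetwork runs mirror descent with the entropy as potential, mixed by doubly stochastic
averaging. Two estimates suffice. Consensus (`consensus`): one multiplicative update moves a
strategy by O(α(t)), so the estimates are a vanishing perturbation of pure averaging. Over a fixed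
number of connectivity windows averaging contracts the spread max − min by a factor below one, so
all agents of a subnetwork asymptotically agree. Regret (`sum_mw_regret_le`): for a fixed strategy
y, the relative entropies from y, summed over agents, do not increase under mixing (Jensen and unit
column sums), and each update decreases them by the linearized regret up to O(α²). Telescoping
bounds the weighted regret by a constant plus Σ α(s)e(s) with e(s) → 0. By consensus the same holds
with a single agent's trajectory in place of the averages and estimates (`MWDynamics.regret`).
Applied to both subnetworks, with scaling by 1/n_l and the zero-sum condition, the terms U(x₁(s),
x₂(s)) cancel. Since U is bilinear, division by Σ α(s) yields U(x̂₁, y₂) − U(y₁, x̂₂) ≤ E(t) → 0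
uniformly in y₁, y₂ (`exists_saddle_error`). This bounds the duality gap; by compactness the
averages accumulate only at equilibria, which also proves existence without a minimax theorem. -/

namespace SubnetworkGame

/-! ### Perturbed averaging over time-varying digraphs. -/

section Consensus

variable {V : Type*}

/-- The nodes which information available at node `i` at time `s` has reached `k` steps later. -/
def informed (G : ℕ → Digraph V) (s : ℕ) (i : V) : ℕ → Set V
  | 0 => {i}
  | k + 1 => {j | ∃ l ∈ informed G s i k, (G (s + k)).Adj l j}

theorem informed_mono {G : ℕ → Digraph V} (hself : ∀ k i, (G k).Adj i i) (s : ℕ) (i : V) :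
    Monotone (informed G s i) :=
  monotone_nat_of_le_succ fun _ j hj => ⟨j, hj, hself _ j⟩

theorem exists_adj_of_reflTransGen {r : V → V → Prop} {S : Set V} {i j : V}
    (h : Relation.ReflTransGen r i j) (hi : i ∈ S) (hj : j ∉ S) :
    ∃ a ∈ S, ∃ b ∉ S, r a b := by
  induction h with
  | refl => exact absurd hi hj
  | @tail b c _ hbc ih =>
    by_cases hb : b ∈ S
    · exact ⟨b, hb, c, hj, hbc⟩
    · exact ih hb

theorem self_mem_informed {G : ℕ → Digraph V} (hself : ∀ k i, (G k).Adj i i) (s : ℕ) (i : V)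
    (k : ℕ) : i ∈ informed G s i k :=
  informed_mono hself s i (Nat.zero_le k) (Set.mem_singleton i)

/-- A path in the union over the window must leave the informed set along some edge. Self-loops keep
the tail of that edge informed until the edge is active, and its head informed until the window
ends. -/
theorem informed_ssubset {G : ℕ → Digraph V} (hself : ∀ k i, (G k).Adj i i) {B : ℕ}
    (hB : ∀ k, StronglyConnected (⨆ t ∈ Set.Ico k (k + B), G t)) (s : ℕ) (i : V) (k : ℕ)
    (hne : informed G s i k ≠ Set.univ) :
    informed G s i k ⊂ informed G s i (k + B) := by
  obtain ⟨j, hj⟩ := (Set.ne_univ_iff_exists_notMem _).1 hne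
  have hi := self_mem_informed hself s i k
  have hij : i ≠ j := fun h => hj (h ▸ hi)
  obtain ⟨a, ha, b, hb, hab⟩ := exists_adj_of_reflTransGen (hB (s + k) i j hij) hi hj
  simp only [Digraph.iSup_adj] at hab
  obtain ⟨t, ht, hab⟩ := hab
  obtain ⟨r, rfl⟩ := Nat.exists_eq_add_of_le ((Nat.le_add_right s k).trans ht.1)
  have h1 : k ≤ r := by have := ht.1; omega
  have h2 : r + 1 ≤ k + B := by have := ht.2; omega
  refine ⟨informed_mono hself s i (Nat.le_add_right k B), fun h => hb (h ?_)⟩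
  exact informed_mono hself s i h2 ⟨a, informed_mono hself s i h1 ha, hab⟩

/-- Every window adds at least one node, so `card V` windows exhaust the network. -/
theorem informed_eq_univ [Fintype V] {G : ℕ → Digraph V} (hself : ∀ k i, (G k).Adj i i) {B : ℕ}
    (hB : ∀ k, StronglyConnected (⨆ t ∈ Set.Ico k (k + B), G t)) (s : ℕ) (i : V) :
    informed G s i (Fintype.card V * B) = Set.univ := by
  have key : ∀ m : ℕ, informed G s i (m * B) = Set.univ ∨ m < (informed G s i (m * B)).ncard := by
    intro m
    induction m with
    | zero => right; simp [informed]
    | succ m ih =>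
      rw [Nat.succ_mul]
      by_cases h : informed G s i (m * B) = Set.univ
      · left
        exact Set.univ_subset_iff.1 (h ▸ informed_mono hself s i (Nat.le_add_right _ B))
      · right
        have := Set.ncard_lt_ncard (informed_ssubset hself hB s i _ h)
        have := ih.resolve_left h
        omega
  refine (key _).resolve_right fun h => ?_
  have := Set.ncard_le_card (informed G s i (Fintype.card V * B))
  rw [Nat.card_eq_fintype_card] at this
  omega

variable [Fintype V]

/-- Perturbed averaging with weights at least `η` on the edges: a node informed by `i` stays
above the minimum by a fixed fraction of the initial excess of `i`. -/
theorem informed_lower_bound {G : ℕ → Digraph V} {W : ℕ → Matrix V V ℝ} {η : ℝ} (hη : 0 < η)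
    (hW : ∀ k, WeightsCompatible η (G k) (W k)) (hrow : ∀ k i, ∑ j, W k i j = 1)
    {y : ℕ → V → ℝ} {ε : ℕ → ℝ}
    (hy : ∀ t i, |y (t + 1) i - ∑ j, W t i j * y t j| ≤ ε t) (s : ℕ) (i : V) {m : ℝ}
    (hm : ∀ j, m ≤ y s j) (k : ℕ) :
    (∀ j, m - ∑ r ∈ Finset.range k, ε (s + r) ≤ y (s + k) j) ∧
    ∀ j ∈ informed G s i k,
      m + η ^ k * (y s i - m) - ∑ r ∈ Finset.range k, ε (s + r) ≤ y (s + k) j := by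
  have hW0 : ∀ k i j, 0 ≤ W k i j := fun k i j => by
    by_cases h : (G k).Adj j i
    · exact hη.le.trans ((hW k i j).1 h)
    · exact ((hW k i j).2 h).ge
  induction k with
  | zero => simpa [informed] using hm
  | succ k ih =>
    set E := ∑ r ∈ Finset.range k, ε (s + r) with hE
    have hsum : ∑ r ∈ Finset.range (k + 1), ε (s + r) = E + ε (s + k) := Finset.sum_range_succ _ _
    -- Rows sum to one, so the averaging acts directly on the excess over the running lower bound `m
    -- - E`, which is nonnegative at every node.
    have step : ∀ j, ∑ l, W (s + k) j l * (y (s + k) l - (m - E)) ≤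
        y (s + (k + 1)) j - (m - (E + ε (s + k))) := by
      intro j
      have h1 := (abs_le.1 (hy (s + k) j)).1
      have h2 : ∑ l, W (s + k) j l * (y (s + k) l - (m - E)) =
          ∑ l, W (s + k) j l * y (s + k) l - (m - E) := by
        simp_rw [mul_sub _ _ (m - E)]
        rw [Finset.sum_sub_distrib, ← Finset.sum_mul, hrow, one_mul]
      rw [h2, ← add_assoc]
      linarith
    have hnn : ∀ j l, 0 ≤ W (s + k) j l * (y (s + k) l - (m - E)) := fun j l =>
      mul_nonneg (hW0 _ _ _) (sub_nonneg.2 (ih.1 l))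
    rw [hsum]
    refine ⟨fun j => ?_, fun j hj => ?_⟩
    · have := Finset.sum_nonneg fun l (_ : l ∈ Finset.univ) => hnn j l
      linarith [step j]
    -- Keeping only the term of one informed neighbor costs a single factor `η`.
    · obtain ⟨l, hl, hlj⟩ := hj
      have h1 := Finset.single_le_sum (fun l _ => hnn j l) (Finset.mem_univ l)
      have h2 : η * (η ^ k * (y s i - m)) ≤ W (s + k) j l * (y (s + k) l - (m - E)) := by
        refine mul_le_mul ((hW _ j l).1 hlj) ?_ ?_ (hW0 _ _ _)
        · linarith [ih.2 l hl]
        · exact mul_nonneg (pow_nonneg hη.le _) (sub_nonneg.2 (hm i))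
      rw [← mul_assoc, ← pow_succ'] at h2
      linarith [step j]

/-- Once `e t < (1 - ρ) * ε`, one step turns the bound `ρ ^ k + ε` into `ρ ^ (k + 1) + ε`; the bound
`d ≤ 1` starts the induction. -/
theorem tendsto_zero_of_contraction {d e : ℕ → ℝ} {ρ : ℝ} {L : ℕ} (hρ0 : 0 ≤ ρ) (hρ1 : ρ < 1)
    (hd0 : ∀ t, 0 ≤ d t) (hd1 : ∀ t, d t ≤ 1) (hstep : ∀ t, d (t + L) ≤ ρ * d t + e t)
    (he : Tendsto e atTop (𝓝 0)) : Tendsto d atTop (𝓝 0) := by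
  have key : ∀ ε > 0, ∀ k : ℕ, ∀ᶠ t in atTop, d t ≤ ρ ^ k + ε := by
    intro ε hε k
    induction k with
    | zero => exact Eventually.of_forall fun t => by simpa using (hd1 t).trans (by linarith)
    | succ k ih =>
      have h1 : ∀ᶠ t in atTop, e t < (1 - ρ) * ε :=
        he.eventually_lt_const (mul_pos (by linarith) hε)
      obtain ⟨T, hT⟩ := eventually_atTop.1 (ih.and h1)
      refine eventually_atTop.2 ⟨T + L, fun t ht => ?_⟩
      obtain ⟨r, rfl⟩ := Nat.exists_eq_add_of_le' ((Nat.le_add_left L T).trans ht)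
      obtain ⟨h2, h3⟩ := hT r (by omega)
      have := mul_le_mul_of_nonneg_left h2 hρ0
      rw [pow_succ']
      linarith [hstep r]
  refine tendsto_order.2 ⟨fun a ha => Eventually.of_forall fun t => ha.trans_le (hd0 t),
    fun a ha => ?_⟩
  obtain ⟨k, hk⟩ := exists_pow_lt_of_lt_one (half_pos ha) hρ1
  filter_upwards [key (a / 2) (half_pos ha) k] with t ht
  linarith

/-- Consensus of perturbed averaging over uniformly jointly strongly connected networks with
vanishing perturbations. -/
theorem consensus [Nonempty V] {G : ℕ → Digraph V} {W : ℕ → Matrix V V ℝ} {η : ℝ} (hη : 0 < η)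
    (hη1 : η < 1) (hconn : UniformlyJointlyStronglyConnected G) (hself : ∀ k i, (G k).Adj i i)
    (hW : ∀ k, WeightsCompatible η (G k) (W k)) (hrow : ∀ k i, ∑ j, W k i j = 1)
    {y : ℕ → V → ℝ} {ε : ℕ → ℝ} (hy0 : ∀ t i, 0 ≤ y t i) (hy1 : ∀ t i, y t i ≤ 1)
    (hy : ∀ t i, |y (t + 1) i - ∑ j, W t i j * y t j| ≤ ε t) (hε : Tendsto ε atTop (𝓝 0))
    (i j : V) : Tendsto (fun t => y t i - y t j) atTop (𝓝 0) := by
  obtain ⟨B, -, hB⟩ := hconn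
  set L := Fintype.card V * B with hL
  set d : ℕ → ℝ := fun t => (⨆ i, y t i) - ⨅ i, y t i with hd
  have hle : ∀ t i, y t i ≤ ⨆ i, y t i := fun t i => le_ciSup (Set.finite_range _).bddAbove i
  have hge : ∀ t i, ⨅ i, y t i ≤ y t i := fun t i => ciInf_le (Set.finite_range _).bddBelow i
  -- The dynamics are invariant under negation, so upper bounds on `y` are lower bounds on `-y`.
  have hneg : ∀ t i, |-y (t + 1) i - ∑ j, W t i j * -y t j| ≤ ε t := by
    intro t i
    have : -y (t + 1) i - ∑ j, W t i j * -y t j = -(y (t + 1) i - ∑ j, W t i j * y t j) := by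
      simp only [mul_neg, Finset.sum_neg_distrib]; ring
    rw [this, abs_neg]; exact hy t i
  have hdlim : Tendsto d atTop (𝓝 0) := by
    refine tendsto_zero_of_contraction (ρ := 1 - η ^ L) (L := L)
      (e := fun t => 2 * ∑ r ∈ Finset.range L, ε (t + r)) ?_ ?_ ?_ ?_ ?_ ?_
    · linarith [pow_le_one₀ (n := L) hη.le hη1.le]
    · linarith [pow_pos hη L]
    · intro t
      have k : V := Classical.arbitrary V
      exact sub_nonneg.2 ((hge t k).trans (hle t k))
    · intro t
      linarith [ciSup_le (hy1 t), le_ciInf (hy0 t)]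
    · intro t
      obtain ⟨a, ha⟩ := exists_eq_ciSup_of_finite (f := y t)
      obtain ⟨b, hb⟩ := exists_eq_ciInf_of_finite (f := y (t + L))
      obtain ⟨c, hc⟩ := exists_eq_ciSup_of_finite (f := y (t + L))
      -- After `L` steps the maximizer `a` has informed every node, so the minimum has risen by `η ^
      -- L * d t` up to the errors. The maximum (`h2`) has risen by at most the errors, whence the
      -- factor 2 in `e`.
      have h1 := (informed_lower_bound hη hW hrow hy t a (hge t) L).2 b
        (by rw [informed_eq_univ hself hB]; trivial)
      have h2 := (informed_lower_bound (y := fun t i => -y t i) hη hW hrow hneg t a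
        (fun j => neg_le_neg (hle t j)) L).1 c
      simp only [hd]
      rw [← hb, ← hc]
      rw [ha] at h1
      linarith
    · have : Tendsto (fun t => ∑ r ∈ Finset.range L, ε (t + r)) atTop
          (𝓝 (∑ r ∈ Finset.range L, 0)) :=
        tendsto_finsetSum _ fun r _ => (tendsto_add_atTop_iff_nat r).2 hε
      simpa using this.const_mul 2
  refine squeeze_zero_norm (fun t => ?_) hdlim
  rw [Real.norm_eq_abs, abs_le]
  constructor <;> simp only [hd] <;> linarith [hle t i, hge t i, hle t j, hge t j]

end Consensus

/-! ### Entropy estimates for one update and the regret of the mixed dynamics. -/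

section MultiplicativeWeights

variable {A : Type*} [Fintype A]

/-- The mixed strategies which play every pure action with positive probability. -/
def openSimplex (A : Type*) [Fintype A] : Set (A → ℝ) := {x | (∀ p, 0 < x p) ∧ ∑ p, x p = 1}

theorem openSimplex_subset_stdSimplex : openSimplex A ⊆ stdSimplex ℝ A :=
  fun _ hx => ⟨fun p => (hx.1 p).le, hx.2⟩

theorem convex_openSimplex : Convex ℝ (openSimplex A) := by
  intro x hx y hy a b ha hb hab
  refine ⟨fun p => ?_, ?_⟩
  · have h := (convex_Ioi (0 : ℝ)) (hx.1 p) (hy.1 p) ha hb hab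
    exact h
  · simp [Finset.sum_add_distrib, ← Finset.mul_sum, hx.2, hy.2, hab]

theorem uniform_mem_openSimplex [Nonempty A] :
    (fun _ => 1 / (Fintype.card A : ℝ)) ∈ openSimplex A :=
  ⟨fun _ => by positivity, by simp⟩

theorem openSimplex_nonempty_index {v : A → ℝ} (hv : v ∈ openSimplex A) : Nonempty A := by
  by_contra h
  rw [not_nonempty_iff] at h
  have := hv.2
  simp at this

theorem partition_pos {a : ℝ} {v g : A → ℝ} (hv : v ∈ openSimplex A) :
    0 < ∑ k, v k * Real.exp (-a * g k) := by
  have := openSimplex_nonempty_index hv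
  exact Finset.sum_pos (fun k _ => mul_pos (hv.1 k) (Real.exp_pos _)) Finset.univ_nonempty

theorem mwUpdate_mem_openSimplex {a : ℝ} {v g : A → ℝ} (hv : v ∈ openSimplex A) :
    mwUpdate a v g ∈ openSimplex A := by
  have hZ := partition_pos (a := a) (g := g) hv
  refine ⟨fun p => div_pos (mul_pos (hv.1 p) (Real.exp_pos _)) hZ, ?_⟩
  simp only [mwUpdate]
  rw [← Finset.sum_div, div_self hZ.ne']

theorem le_one_of_mem_stdSimplex {v : A → ℝ} (hv : v ∈ stdSimplex ℝ A) (p : A) : v p ≤ 1 :=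
  hv.2 ▸ Finset.single_le_sum (fun q _ => hv.1 q) (Finset.mem_univ p)

/-- A second-order Taylor bound valid for every `z`, so that no smallness of the step-size is needed
later. -/
theorem exp_le_one_add_add_sq_mul_exp (z : ℝ) :
    Real.exp z ≤ 1 + z + |z| ^ 2 * Real.exp |z| := by
  have h := Complex.norm_exp_sub_sum_le_norm_mul_exp (z : ℂ) 2
  have h2 : Complex.exp z - ∑ m ∈ Finset.range 2, (z : ℂ) ^ m / m.factorial =
      ((Real.exp z - (1 + z) : ℝ) : ℂ) := by
    simp [Finset.sum_range_succ]
  rw [h2, Complex.norm_real, Complex.norm_real, Real.norm_eq_abs, Real.norm_eq_abs] at h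
  linarith [le_abs_self (Real.exp z - (1 + z))]

/-- Combines `log Z ≤ Z - 1` with the second-order expansion of each exponential; the first-order
part is the expected cost under `v`. -/
theorem log_partition_le {a K : ℝ} {v g : A → ℝ} (ha : 0 ≤ a) (hv : v ∈ openSimplex A)
    (hg : ∀ p, |g p| ≤ K) :
    Real.log (∑ k, v k * Real.exp (-a * g k)) ≤
      -a * ∑ p, g p * v p + (a * K) ^ 2 * Real.exp (a * K) := by
  have hb : ∀ k, v k * Real.exp (-a * g k) ≤
      v k + -a * (g k * v k) + v k * ((a * K) ^ 2 * Real.exp (a * K)) := by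
    intro k
    have h1 : |-a * g k| ≤ a * K := by
      rw [abs_mul, abs_neg, abs_of_nonneg ha]
      exact mul_le_mul_of_nonneg_left (hg k) ha
    have h2 : |-a * g k| ^ 2 * Real.exp |-a * g k| ≤ (a * K) ^ 2 * Real.exp (a * K) := by
      gcongr
    have h3 := (exp_le_one_add_add_sq_mul_exp (-a * g k)).trans (add_le_add_right h2 _)
    calc _ ≤ _ := mul_le_mul_of_nonneg_left h3 (hv.1 k).le
      _ = _ := by ring
  have hs := Finset.sum_le_sum fun k (_ : k ∈ Finset.univ) => hb k
  rw [Finset.sum_add_distrib, Finset.sum_add_distrib, ← Finset.mul_sum, ← Finset.sum_mul, hv.2,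
    one_mul] at hs
  linarith [Real.log_le_sub_one_of_pos (partition_pos (a := a) (g := g) hv)]

theorem log_mwUpdate {a : ℝ} {v g : A → ℝ} (hv : v ∈ openSimplex A) (p : A) :
    Real.log (mwUpdate a v g p) =
      Real.log (v p) - a * g p - Real.log (∑ k, v k * Real.exp (-a * g k)) := by
  rw [mwUpdate, Real.log_div (mul_pos (hv.1 p) (Real.exp_pos _)).ne' (partition_pos hv).ne',
    Real.log_mul (hv.1 p).ne' (Real.exp_pos _).ne', Real.log_exp]
  ring

/-- One multiplicative-weight update decreases the relative entropy from `y` by at least the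
linearized regret against `y`, up to a term of second order. -/
theorem mwUpdate_regret {a K : ℝ} {v g y : A → ℝ} (ha : 0 ≤ a) (hv : v ∈ openSimplex A)
    (hg : ∀ p, |g p| ≤ K) (hy : y ∈ stdSimplex ℝ A) :
    a * ∑ p, g p * (v p - y p) ≤
      ∑ p, y p * Real.log (mwUpdate a v g p) - ∑ p, y p * Real.log (v p) +
        (a * K) ^ 2 * Real.exp (a * K) := by
  have h1 : ∑ p, y p * Real.log (mwUpdate a v g p) = ∑ p, y p * Real.log (v p) -
      a * ∑ p, g p * y p - Real.log (∑ k, v k * Real.exp (-a * g k)) := by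
    simp_rw [log_mwUpdate hv, mul_sub]
    rw [Finset.sum_sub_distrib, Finset.sum_sub_distrib, ← Finset.sum_mul, hy.2, one_mul,
      Finset.mul_sum]
    congr 2
    exact Finset.sum_congr rfl fun p _ => by ring
  have h2 : ∑ p, g p * (v p - y p) = ∑ p, g p * v p - ∑ p, g p * y p := by
    simp_rw [mul_sub, Finset.sum_sub_distrib]
  rw [h1, h2]
  linarith [log_partition_le ha hv hg]

/-- The update multiplies `v p` by the ratio of an exponential to an average of such exponentials.
Both lie between `exp (-(a * K))` and `exp (a * K)`, so the ratio is within `exp (±2 a K)`. -/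
theorem abs_mwUpdate_sub_le {a K : ℝ} {v g : A → ℝ} (ha : 0 ≤ a) (hv : v ∈ openSimplex A)
    (hg : ∀ p, |g p| ≤ K) (p : A) : |mwUpdate a v g p - v p| ≤ Real.exp (2 * (a * K)) - 1 := by
  have hlo : ∀ k, Real.exp (-(a * K)) ≤ Real.exp (-a * g k) := fun k => by
    have := mul_le_mul_of_nonneg_left (abs_le.1 (hg k)).2 ha
    exact Real.exp_le_exp.2 (by linarith)
  have hhi : ∀ k, Real.exp (-a * g k) ≤ Real.exp (a * K) := fun k => by
    have := mul_le_mul_of_nonneg_left (abs_le.1 (hg k)).1 ha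
    exact Real.exp_le_exp.2 (by linarith)
  set Z := ∑ k, v k * Real.exp (-a * g k) with hZ
  have hZ0 : 0 < Z := partition_pos hv
  have hZlo : Real.exp (-(a * K)) ≤ Z := by
    have := Finset.sum_le_sum fun k (_ : k ∈ Finset.univ) =>
      mul_le_mul_of_nonneg_left (hlo k) (hv.1 k).le
    rwa [← Finset.sum_mul, hv.2, one_mul] at this
  have hZhi : Z ≤ Real.exp (a * K) := by
    have := Finset.sum_le_sum fun k (_ : k ∈ Finset.univ) =>
      mul_le_mul_of_nonneg_left (hhi k) (hv.1 k).le
    rwa [← Finset.sum_mul, hv.2, one_mul] at this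
  set r := Real.exp (-a * g p) / Z with hr
  have hr1 : r ≤ Real.exp (2 * (a * K)) := by
    rw [hr, div_le_iff₀ hZ0]
    calc _ ≤ Real.exp (a * K) := hhi p
      _ = Real.exp (2 * (a * K)) * Real.exp (-(a * K)) := by rw [← Real.exp_add]; ring_nf
      _ ≤ _ := mul_le_mul_of_nonneg_left hZlo (Real.exp_pos _).le
  have hr2 : Real.exp (-(2 * (a * K))) ≤ r := by
    rw [hr, le_div_iff₀ hZ0]
    calc _ ≤ Real.exp (-(2 * (a * K))) * Real.exp (a * K) :=
          mul_le_mul_of_nonneg_left hZhi (Real.exp_pos _).le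
      _ = Real.exp (-(a * K)) := by rw [← Real.exp_add]; ring_nf
      _ ≤ _ := hlo p
  have hr3 : |r - 1| ≤ Real.exp (2 * (a * K)) - 1 := by
    rw [abs_le]
    constructor
    · linarith [Real.add_one_le_exp (2 * (a * K)), Real.add_one_le_exp (-(2 * (a * K)))]
    · linarith
  have : mwUpdate a v g p - v p = v p * (r - 1) := by
    rw [mwUpdate, hr]; ring
  rw [this, abs_mul, abs_of_pos (hv.1 p)]
  calc _ ≤ 1 * |r - 1| := mul_le_mul_of_nonneg_right
        (le_one_of_mem_stdSimplex (openSimplex_subset_stdSimplex hv) p) (abs_nonneg _)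
    _ ≤ _ := by rwa [one_mul]

variable {V : Type*} [Fintype V]

theorem weightedSum_mem_openSimplex {w : V → ℝ} (hw : ∀ j, 0 ≤ w j) (hw1 : ∑ j, w j = 1)
    {x : V → A → ℝ} (hx : ∀ j, x j ∈ openSimplex A) : ∑ j, w j • x j ∈ openSimplex A :=
  convex_openSimplex.sum_mem (fun j _ => hw j) hw1 fun j _ => hx j

/-- Jensen's inequality for the logarithm: mixing cannot increase the averaged relative entropy from
`y`. -/
theorem weightedSum_log_le {w : V → ℝ} (hw : ∀ j, 0 ≤ w j) (hw1 : ∑ j, w j = 1)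
    {x : V → A → ℝ} (hx : ∀ j, x j ∈ openSimplex A) {y : A → ℝ} (hy : y ∈ stdSimplex ℝ A) :
    ∑ j, w j * ∑ p, y p * Real.log (x j p) ≤
      ∑ p, y p * Real.log ((∑ j, w j • x j) p) := by
  simp_rw [Finset.mul_sum]
  rw [Finset.sum_comm]
  refine Finset.sum_le_sum fun p _ => ?_
  have h := strictConcaveOn_log_Ioi.concaveOn.le_map_sum (t := Finset.univ) (w := w)
    (p := fun j => x j p) (fun j _ => hw j) hw1 fun j _ => (hx j).1 p
  simp only [Finset.sum_apply, Pi.smul_apply]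
  calc _ = y p * ∑ j, w j • Real.log (x j p) := by
        rw [Finset.mul_sum]
        exact Finset.sum_congr rfl fun j _ => by rw [smul_eq_mul]; ring
    _ ≤ _ := mul_le_mul_of_nonneg_left h (hy.1 p)

/-- Regret of distributed multiplicative weights with doubly stochastic mixing. -/
theorem sum_mw_regret_le [Nonempty A] {W : ℕ → Matrix V V ℝ} (hW : ∀ t i j, 0 ≤ W t i j)
    (hrow : ∀ t i, ∑ j, W t i j = 1) (hcol : ∀ t j, ∑ i, W t i j = 1) {α : ℕ → ℝ}
    (hα : ∀ t, 0 ≤ α t) {K : ℝ} {x g : ℕ → V → A → ℝ} (hg : ∀ t i p, |g t i p| ≤ K)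
    (hx : ∀ t i, x t i ∈ openSimplex A) (hx0 : ∀ i, x 0 i = fun _ => 1 / (Fintype.card A : ℝ))
    (hstep : ∀ t i, x (t + 1) i = mwUpdate (α t) (∑ j, W t i j • x t j) (g t i))
    {y : A → ℝ} (hy : y ∈ stdSimplex ℝ A) (T : ℕ) :
    ∑ s ∈ Finset.range T, α s * ∑ i, ∑ p, g s i p * ((∑ j, W s i j • x s j) p - y p) ≤
      Fintype.card V * Real.log (Fintype.card A) +
        ∑ s ∈ Finset.range T, α s * (Fintype.card V * (α s * K ^ 2 * Real.exp (α s * K))) := by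
  -- Up to a constant depending on `y`, `Ψ` is minus the total relative entropy from `y`. It is
  -- never positive, and the uniform start makes its initial value independent of `y`.
  set Ψ : ℕ → ℝ := fun t => ∑ i, ∑ p, y p * Real.log (x t i p) with hΨ
  have step : ∀ s, α s * ∑ i, ∑ p, g s i p * ((∑ j, W s i j • x s j) p - y p) ≤
      Ψ (s + 1) - Ψ s + α s * (Fintype.card V * (α s * K ^ 2 * Real.exp (α s * K))) := by
    intro s
    have h1 := Finset.sum_le_sum fun i (_ : i ∈ Finset.univ) =>
      mwUpdate_regret (hα s) (weightedSum_mem_openSimplex (hW s i) (hrow s i) (hx s)) (hg s i) hy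
    simp only [← hstep] at h1
    rw [← Finset.mul_sum, Finset.sum_add_distrib, Finset.sum_sub_distrib] at h1
    have h2 := Finset.sum_le_sum fun i (_ : i ∈ Finset.univ) =>
      weightedSum_log_le (hW s i) (hrow s i) (hx s) hy
    -- Summed over the agents, each `x s j` receives its column sum as total weight, which is one;
    -- so mixing does not decrease `Ψ`.
    rw [Finset.sum_comm] at h2
    simp only [← Finset.sum_mul, hcol, one_mul] at h2
    simp only [Finset.sum_const, Finset.card_univ, nsmul_eq_mul] at h1
    simp only [hΨ]
    have h3 : α s * (Fintype.card V * (α s * K ^ 2 * Real.exp (α s * K))) =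
      Fintype.card V * ((α s * K) ^ 2 * Real.exp (α s * K)) := by ring
    rw [h3]
    linarith
  refine (Finset.sum_le_sum fun s _ => step s).trans ?_
  rw [Finset.sum_add_distrib, Finset.sum_range_sub]
  have hT : Ψ T ≤ 0 := Finset.sum_nonpos fun i _ => Finset.sum_nonpos fun p _ =>
    mul_nonpos_of_nonneg_of_nonpos (hy.1 p) (Real.log_nonpos ((hx T i).1 p).le
      (le_one_of_mem_stdSimplex (openSimplex_subset_stdSimplex (hx T i)) p))
  have h0 : Ψ 0 = -(Fintype.card V * Real.log (Fintype.card A)) := by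
    simp [hΨ, hx0, ← Finset.sum_mul, hy.2]
  linarith

end MultiplicativeWeights

/-! ### Bilinearity and Lipschitz bounds of expected costs. -/

section ExpectedCosts

variable {A B : Type*} [Fintype A] [Fintype B]

/-- The `ℓ¹` distance of two vectors. -/
def l1Dist (x y : A → ℝ) : ℝ := ∑ p, |x p - y p|

theorem l1Dist_nonneg (x y : A → ℝ) : 0 ≤ l1Dist x y := Finset.sum_nonneg fun _ _ => abs_nonneg _

theorem l1Dist_self (x : A → ℝ) : l1Dist x x = 0 := by simp [l1Dist]

theorem l1Dist_comm (x y : A → ℝ) : l1Dist x y = l1Dist y x :=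
  Finset.sum_congr rfl fun _ _ => abs_sub_comm _ _

theorem expCost_swap (c : A → B → ℝ) (x : A → ℝ) (y : B → ℝ) :
    expCost (fun q p => c p q) y x = expCost c x y := by
  simp only [expCost]
  rw [Finset.sum_comm]
  exact Finset.sum_congr rfl fun p _ => Finset.sum_congr rfl fun q _ => by ring

theorem expCost_eq_sum_pureStrategy (c : A → B → ℝ) (x : A → ℝ) (y : B → ℝ) :
    expCost c x y = ∑ p, expCost c (pureStrategy p) y * x p := by
  simp only [expCost, pureStrategy]
  refine Finset.sum_congr rfl fun p _ => ?_
  rw [Finset.sum_eq_single p]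
  · rw [Finset.sum_mul]
    exact Finset.sum_congr rfl fun q _ => by simp; ring
  · intro r _ hr; simp [hr]
  · simp

theorem pureStrategy_mem_stdSimplex (p : A) : pureStrategy p ∈ stdSimplex ℝ A := by
  constructor
  · intro q; unfold pureStrategy; split_ifs <;> norm_num
  · simp [pureStrategy]

/-- Exchange one argument at a time. The factor left unchanged is `y` or `x'` and has total mass
one, so only these two need to be strategies. -/
theorem expCost_sub_le {c : A → B → ℝ} {C : ℝ} (hc : ∀ p q, |c p q| ≤ C) {x x' : A → ℝ}
    {y y' : B → ℝ} (hx' : x' ∈ stdSimplex ℝ A) (hy : y ∈ stdSimplex ℝ B) :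
    expCost c x y - expCost c x' y' ≤ C * (l1Dist x x' + l1Dist y y') := by
  have h1 : ∀ p q, x p * y q * c p q - x' p * y' q * c p q ≤
      C * (|x p - x' p| * y q + x' p * |y q - y' q|) := by
    intro p q
    have e : x p * y q * c p q - x' p * y' q * c p q =
        ((x p - x' p) * y q + x' p * (y q - y' q)) * c p q := by ring
    have b : |(x p - x' p) * y q + x' p * (y q - y' q)| ≤
        |x p - x' p| * y q + x' p * |y q - y' q| := by
      refine (abs_add_le _ _).trans ?_
      rw [abs_mul, abs_mul, abs_of_nonneg (hy.1 q), abs_of_nonneg (hx'.1 p)]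
    rw [e, mul_comm C]
    refine (le_abs_self _).trans ?_
    rw [abs_mul]
    exact mul_le_mul b (hc p q) (abs_nonneg _) ((abs_nonneg _).trans b)
  have h2 := Finset.sum_le_sum fun p (_ : p ∈ Finset.univ) =>
    Finset.sum_le_sum fun q (_ : q ∈ Finset.univ) => h1 p q
  simp only [Finset.sum_sub_distrib, ← Finset.mul_sum, Finset.sum_add_distrib,
    ← Finset.sum_mul, hy.2, hx'.2, mul_one, one_mul] at h2
  exact h2

theorem abs_expCost_le {c : A → B → ℝ} {C : ℝ} (hc : ∀ p q, |c p q| ≤ C) {x : A → ℝ}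
    {y : B → ℝ} (hx : x ∈ stdSimplex ℝ A) (hy : y ∈ stdSimplex ℝ B) :
    |expCost c x y| ≤ C := by
  refine (Finset.abs_sum_le_sum_abs _ _).trans ?_
  have h : ∀ p, |∑ q, x p * y q * c p q| ≤ x p * C := by
    intro p
    refine (Finset.abs_sum_le_sum_abs _ _).trans ?_
    calc _ ≤ ∑ q, x p * (y q * C) := Finset.sum_le_sum fun q _ => by
          rw [abs_mul, abs_mul, abs_of_nonneg (hx.1 p), abs_of_nonneg (hy.1 q), mul_assoc]
          exact mul_le_mul_of_nonneg_left (mul_le_mul_of_nonneg_left (hc p q) (hy.1 q)) (hx.1 p)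
      _ = x p * C := by rw [← Finset.mul_sum, ← Finset.sum_mul, hy.2, one_mul]
  calc _ ≤ ∑ p, x p * C := Finset.sum_le_sum fun p _ => h p
    _ = C := by rw [← Finset.sum_mul, hx.2, one_mul]

/-- Bounding each weight by one gives a bound free of the time-varying weights, which tends to zero
as soon as every summand does. -/
theorem l1Dist_weightedSum_le {V : Type*} [Fintype V] {w : V → ℝ} (hw : ∀ j, 0 ≤ w j)
    (hw1 : ∑ j, w j = 1) (x : V → A → ℝ) (z : A → ℝ) :
    l1Dist (∑ j, w j • x j) z ≤ ∑ j, l1Dist (x j) z := by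
  have hle : ∀ j, w j ≤ 1 := fun j => le_one_of_mem_stdSimplex ⟨hw, hw1⟩ j
  have h1 : ∀ p, |(∑ j, w j • x j) p - z p| ≤ ∑ j, |x j p - z p| := by
    intro p
    have e : (∑ j, w j • x j) p - z p = ∑ j, w j * (x j p - z p) := by
      simp only [Finset.sum_apply, Pi.smul_apply, smul_eq_mul, mul_sub, Finset.sum_sub_distrib]
      rw [← Finset.sum_mul, hw1, one_mul]
    rw [e]
    refine (Finset.abs_sum_le_sum_abs _ _).trans (Finset.sum_le_sum fun j _ => ?_)
    rw [abs_mul, abs_of_nonneg (hw j)]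
    exact mul_le_of_le_one_left (abs_nonneg _) (hle j)
  refine (Finset.sum_le_sum fun p _ => h1 p).trans ?_
  rw [Finset.sum_comm]
  rfl

end ExpectedCosts

/-! ### One subnetwork facing an estimated opponent. -/

/-- Agents `V` with pure actions `A` run distributed multiplicative weights with costs `c`, where
agent `i` uses the estimate `u t i` of the strategy of an opponent with pure actions `B`. -/
structure MWDynamics {V A B : Type*} [Fintype V] [Fintype A] [Fintype B] (c : V → A → B → ℝ)
    (α : ℕ → ℝ) (G : ℕ → Digraph V) (W : ℕ → Matrix V V ℝ) (x : ℕ → V → A → ℝ)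
    (u : ℕ → V → B → ℝ) : Prop where
  connected : UniformlyJointlyStronglyConnected G
  self : ∀ k i, (G k).Adj i i
  weights : ∃ η : ℝ, 0 < η ∧ η < 1 ∧ ∀ k, WeightsCompatible η (G k) (W k)
  rowSum : ∀ k i, ∑ j, W k i j = 1
  colSum : ∀ k j, ∑ i, W k i j = 1
  step_nonneg : ∀ t, 0 ≤ α t
  step_tendsto : Tendsto α atTop (𝓝 0)
  opponent_mem : ∀ t i, u t i ∈ stdSimplex ℝ B
  mem : ∀ t i, x t i ∈ openSimplex A
  init : ∀ i, x 0 i = fun _ => 1 / (Fintype.card A : ℝ)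
  update : ∀ t i, x (t + 1) i = mwUpdate (α t) (∑ j, W t i j • x t j)
    (fun p => expCost (c i) (pureStrategy p) (u t i))

theorem WeightsCompatible.nonneg {V : Type*} {η : ℝ} (hη : 0 < η) {G : Digraph V}
    {W : Matrix V V ℝ} (h : WeightsCompatible η G W) (i j : V) : 0 ≤ W i j := by
  by_cases hij : G.Adj j i
  · exact hη.le.trans ((h i j).1 hij)
  · exact ((h i j).2 hij).ge

namespace MWDynamics

variable {V A B : Type*} [Fintype V] [Fintype A] [Fintype B] {c : V → A → B → ℝ}
  {α : ℕ → ℝ} {G : ℕ → Digraph V} {W : ℕ → Matrix V V ℝ} {x : ℕ → V → A → ℝ}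
  {u : ℕ → V → B → ℝ}

theorem weight_nonneg (h : MWDynamics c α G W x u) (t : ℕ) (i j : V) : 0 ≤ W t i j := by
  obtain ⟨η, hη, -, hW⟩ := h.weights
  exact (hW t).nonneg hη i j

theorem exists_cost_bound (c : V → A → B → ℝ) : ∃ C, 0 ≤ C ∧ ∀ i p q, |c i p q| ≤ C := by
  refine ⟨∑ i, ∑ p, ∑ q, |c i p q|, by positivity, fun i p q => ?_⟩
  calc |c i p q| ≤ ∑ q, |c i p q| :=
        Finset.single_le_sum (fun q _ => abs_nonneg (c i p q)) (Finset.mem_univ q)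
    _ ≤ ∑ p, ∑ q, |c i p q| :=
        Finset.single_le_sum (f := fun p => ∑ q, |c i p q|) (fun p _ => by positivity)
          (Finset.mem_univ p)
    _ ≤ _ := Finset.single_le_sum (f := fun i => ∑ p, ∑ q, |c i p q|) (fun i _ => by positivity)
          (Finset.mem_univ i)

theorem tendsto_l1Dist (h : MWDynamics c α G W x u) (i j : V) :
    Tendsto (fun t => l1Dist (x t i) (x t j)) atTop (𝓝 0) := by
  obtain ⟨η, hη, hη1, hW⟩ := h.weights
  obtain ⟨C, -, hC⟩ := exists_cost_bound c
  have hε : Tendsto (fun t => Real.exp (2 * (α t * C)) - 1) atTop (𝓝 0) := by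
    have h1 : Tendsto (fun t => 2 * (α t * C)) atTop (𝓝 0) := by
      simpa using (h.step_tendsto.mul_const C).const_mul 2
    simpa using ((Real.continuous_exp.tendsto 0).comp h1).sub_const 1
  have : Nonempty V := ⟨i⟩
  have key : ∀ p, Tendsto (fun t => x t i p - x t j p) atTop (𝓝 0) := by
    intro p
    refine consensus (y := fun t i => x t i p) hη hη1 h.connected h.self hW h.rowSum
      (fun t i => ((h.mem t i).1 p).le)
      (fun t i => le_one_of_mem_stdSimplex (openSimplex_subset_stdSimplex (h.mem t i)) p)
      (fun t i => ?_) hε i j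
    have := abs_mwUpdate_sub_le (h.step_nonneg t)
      (weightedSum_mem_openSimplex (h.weight_nonneg t i) (h.rowSum t i) (h.mem t))
      (fun p => abs_expCost_le (hC i) (pureStrategy_mem_stdSimplex p) (h.opponent_mem t i)) p
    rw [← h.update] at this
    simpa only [Finset.sum_apply, Pi.smul_apply, smul_eq_mul] using this
  have := tendsto_finsetSum Finset.univ fun p _ => (key p).abs
  simpa [l1Dist] using this

/-- Regret of the strategies of a single agent with respect to the sum of the costs of all
agents, for opponents' strategies that the agents estimate consistently. -/
theorem regret [Nonempty A] (h : MWDynamics c α G W x u) (i : V) {z : ℕ → B → ℝ}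
    (hz : ∀ t, z t ∈ stdSimplex ℝ B)
    (huz : ∀ k, Tendsto (fun t => l1Dist (u t k) (z t)) atTop (𝓝 0)) :
    ∃ (K : ℝ) (e : ℕ → ℝ), Tendsto e atTop (𝓝 0) ∧ ∀ y ∈ stdSimplex ℝ A, ∀ T,
      ∑ s ∈ Finset.range T, α s *
        (∑ k, expCost (c k) (x s i) (z s) - ∑ k, expCost (c k) y (z s)) ≤
      K + ∑ s ∈ Finset.range T, α s * e s := by
  obtain ⟨C, -, hC⟩ := exists_cost_bound c
  -- The first summand pays for replacing agent `k`'s average and estimate by `x s i` and `z s`, the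
  -- second for replacing the estimate by `z s` in the cost of the comparison strategy `y`.
  set δ : ℕ → V → ℝ := fun s k =>
    C * (l1Dist (∑ j, W s k j • x s j) (x s i) + l1Dist (u s k) (z s)) +
      C * l1Dist (u s k) (z s) with hδ
  have hvlim : ∀ k, Tendsto (fun s => l1Dist (∑ j, W s k j • x s j) (x s i)) atTop (𝓝 0) := by
    intro k
    refine squeeze_zero (fun s => l1Dist_nonneg _ _)
      (fun s => l1Dist_weightedSum_le (h.weight_nonneg s k) (h.rowSum s k) _ _) ?_
    simpa using tendsto_finsetSum Finset.univ fun j _ => h.tendsto_l1Dist j i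
  have hδlim : Tendsto (fun s => ∑ k, δ s k) atTop (𝓝 0) := by
    have : ∀ k, Tendsto (fun s => δ s k) atTop (𝓝 0) := fun k => by
      simpa [hδ] using (((hvlim k).add (huz k)).const_mul C).add ((huz k).const_mul C)
    simpa using tendsto_finsetSum Finset.univ fun k _ => this k
  have hclim : Tendsto (fun s => (Fintype.card V : ℝ) * (α s * C ^ 2 * Real.exp (α s * C)))
      atTop (𝓝 0) := by
    have h1 : Tendsto (fun s => Real.exp (α s * C)) atTop (𝓝 1) := by
      have : Tendsto (fun s => α s * C) atTop (𝓝 0) := by simpa using h.step_tendsto.mul_const C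
      simpa [Function.comp_def] using (Real.continuous_exp.tendsto 0).comp this
    simpa using ((h.step_tendsto.mul_const (C ^ 2)).mul h1).const_mul (Fintype.card V : ℝ)
  refine ⟨Fintype.card V * Real.log (Fintype.card A), _, by simpa using hδlim.add hclim,
    fun y hy T => ?_⟩
  have hreg := sum_mw_regret_le h.weight_nonneg h.rowSum h.colSum h.step_nonneg
    (fun t k p => abs_expCost_le (hC k) (pureStrategy_mem_stdSimplex p) (h.opponent_mem t k))
    h.mem h.init h.update hy T
  have hterm : ∀ s, ∑ k, expCost (c k) (x s i) (z s) - ∑ k, expCost (c k) y (z s) ≤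
      ∑ k, ∑ p, expCost (c k) (pureStrategy p) (u s k) * ((∑ j, W s k j • x s j) p - y p) +
        ∑ k, δ s k := by
    intro s
    rw [← Finset.sum_sub_distrib, ← Finset.sum_add_distrib]
    refine Finset.sum_le_sum fun k _ => ?_
    have hv := openSimplex_subset_stdSimplex
      (weightedSum_mem_openSimplex (h.weight_nonneg s k) (h.rowSum s k) (h.mem s))
    simp only [mul_sub, Finset.sum_sub_distrib]
    rw [← expCost_eq_sum_pureStrategy, ← expCost_eq_sum_pureStrategy]
    have h1 := expCost_sub_le (hC k) (x := x s i) (y := z s) (y' := u s k) hv (hz s)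
    have h2 := expCost_sub_le (hC k) (x := y) (y' := z s) hy (h.opponent_mem s k)
    rw [l1Dist_self, zero_add] at h2
    rw [l1Dist_comm (x s i), l1Dist_comm (z s)] at h1
    simp only [hδ]
    linarith
  calc _ ≤ _ := Finset.sum_le_sum fun s _ =>
        mul_le_mul_of_nonneg_left (hterm s) (h.step_nonneg s)
    _ ≤ _ := by
      simp only [mul_add, Finset.sum_add_distrib] at hreg ⊢
      linarith

end MWDynamics

/-! ### Step-size weighted averages. -/

section Averages

theorem ergodicAverage_eq {A : Type*} (α : ℕ → ℝ) (x : ℕ → A → ℝ) (t : ℕ) :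
    ergodicAverage α x t =
      ∑ s ∈ Finset.range t, (1 / (∑ r ∈ Finset.range t, α r) * α s) • x s := by
  simp only [ergodicAverage, Finset.smul_sum, smul_smul]

variable {A B : Type*} [Fintype A] [Fintype B]

theorem expCost_sum_left {ι : Type*} (S : Finset ι) (w : ι → ℝ) (x : ι → A → ℝ) (y : B → ℝ)
    (c : A → B → ℝ) :
    expCost c (∑ s ∈ S, w s • x s) y = ∑ s ∈ S, w s * expCost c (x s) y := by
  have h : ∀ s, expCost c (x s) y = ∑ p, expCost c (pureStrategy p) y * x s p :=
    fun s => expCost_eq_sum_pureStrategy c (x s) y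
  rw [expCost_eq_sum_pureStrategy]
  simp_rw [h, Finset.sum_apply, Pi.smul_apply, smul_eq_mul,
    Finset.mul_sum]
  rw [Finset.sum_comm]
  exact Finset.sum_congr rfl fun s _ => Finset.sum_congr rfl fun p _ => by ring

theorem expCost_ergodicAverage_left (c : A → B → ℝ) (α : ℕ → ℝ) (x : ℕ → A → ℝ) (y : B → ℝ)
    (t : ℕ) :
    expCost c (ergodicAverage α x t) y =
      1 / (∑ s ∈ Finset.range t, α s) * ∑ s ∈ Finset.range t, α s * expCost c (x s) y := by
  rw [ergodicAverage_eq, expCost_sum_left, Finset.mul_sum]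
  exact Finset.sum_congr rfl fun s _ => by ring

theorem expCost_ergodicAverage_right (c : A → B → ℝ) (α : ℕ → ℝ) (x : A → ℝ) (y : ℕ → B → ℝ)
    (t : ℕ) :
    expCost c x (ergodicAverage α y t) =
      1 / (∑ s ∈ Finset.range t, α s) * ∑ s ∈ Finset.range t, α s * expCost c x (y s) := by
  simp only [← expCost_swap c x, expCost_ergodicAverage_left]

theorem ergodicAverage_mem_stdSimplex {α : ℕ → ℝ} (hα : ∀ t, 0 ≤ α t) {x : ℕ → A → ℝ}
    (hx : ∀ t, x t ∈ stdSimplex ℝ A) {t : ℕ} (ht : 0 < ∑ s ∈ Finset.range t, α s) :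
    ergodicAverage α x t ∈ stdSimplex ℝ A := by
  rw [ergodicAverage_eq]
  refine (convex_stdSimplex ℝ A).sum_mem (fun s _ => ?_) ?_ fun s _ => hx s
  · exact mul_nonneg (one_div_nonneg.2 ht.le) (hα s)
  · rw [← Finset.mul_sum, one_div_mul_cancel ht.ne']

/-- The weighted Cesàro lemma: `α s * e s` is little-o of `α s`, and this passes to partial sums
because those of `α` diverge. -/
theorem tendsto_weighted_average {α e : ℕ → ℝ} (hα : ∀ t, 0 ≤ α t)
    (hsum : Tendsto (fun t => ∑ s ∈ Finset.range t, α s) atTop atTop)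
    (he : Tendsto e atTop (𝓝 0)) :
    Tendsto (fun t => 1 / (∑ s ∈ Finset.range t, α s) * ∑ s ∈ Finset.range t, α s * e s)
      atTop (𝓝 0) := by
  have h1 : (fun s => α s * e s) =o[atTop] α := by
    simpa using (Asymptotics.isBigO_refl α atTop).mul_isLittleO
      ((Asymptotics.isLittleO_one_iff ℝ).2 he)
  simpa [div_eq_inv_mul] using (h1.sum_range hα hsum).tendsto_div_nhds_zero

theorem continuous_expCost (c : A → B → ℝ) :
    Continuous fun z : (A → ℝ) × (B → ℝ) => expCost c z.1 z.2 := by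
  unfold expCost
  fun_prop

end Averages

/-! ### Approximate saddle points and equilibria. -/

namespace FiniteGame

variable {V₁ V₂ A₁ A₂ : Type*} [Fintype V₁] [Fintype A₁] [Fintype A₂]

theorem globalCost₁_eq_expCost (Γ : FiniteGame V₁ V₂ A₁ A₂) (x₁ : A₁ → ℝ) (x₂ : A₂ → ℝ) :
    Γ.globalCost₁ x₁ x₂ =
      expCost (fun p q => 1 / (Fintype.card V₁ : ℝ) * ∑ i, Γ.cost₁ i p q) x₁ x₂ := by
  simp only [globalCost₁, expCost, Finset.mul_sum]
  rw [Finset.sum_comm]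
  refine Finset.sum_congr rfl fun p _ => ?_
  rw [Finset.sum_comm]
  exact Finset.sum_congr rfl fun q _ => Finset.sum_congr rfl fun i _ => by ring

theorem continuous_globalCost₁ (Γ : FiniteGame V₁ V₂ A₁ A₂) :
    Continuous fun z : (A₁ → ℝ) × (A₂ → ℝ) => Γ.globalCost₁ z.1 z.2 := by
  simp only [globalCost₁_eq_expCost]
  exact continuous_expCost _

theorem tendsto_globalCost₁ (Γ : FiniteGame V₁ V₂ A₁ A₂) {ι : Type*} {l : Filter ι}
    {f : ι → A₁ → ℝ} {g : ι → A₂ → ℝ} {x₁ : A₁ → ℝ} {x₂ : A₂ → ℝ} (hf : Tendsto f l (𝓝 x₁))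
    (hg : Tendsto g l (𝓝 x₂)) :
    Tendsto (fun t => Γ.globalCost₁ (f t) (g t)) l (𝓝 (Γ.globalCost₁ x₁ x₂)) := by
  have h := (Γ.continuous_globalCost₁.tendsto (x₁, x₂)).comp (hf.prodMk_nhds hg)
  simpa only [Function.comp_def] using h

/-- Both optimality conditions are the saddle inequality with one of `y₁`, `y₂` taken from `z`
itself. -/
theorem mem_mixedNash_of_forall_le (Γ : FiniteGame V₁ V₂ A₁ A₂) {z : (A₁ → ℝ) × (A₂ → ℝ)}
    (h₁ : z.1 ∈ stdSimplex ℝ A₁) (h₂ : z.2 ∈ stdSimplex ℝ A₂)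
    (h : ∀ y₁ ∈ stdSimplex ℝ A₁, ∀ y₂ ∈ stdSimplex ℝ A₂,
      Γ.globalCost₁ z.1 y₂ ≤ Γ.globalCost₁ y₁ z.2) : z ∈ Γ.mixedNash :=
  ⟨h₁, h₂, fun y₁ hy₁ => h y₁ hy₁ z.2 h₂, fun y₂ hy₂ => h z.1 h₁ y₂ hy₂⟩

theorem dualityGap_nonneg (Γ : FiniteGame V₁ V₂ A₁ A₂) {x₁ : A₁ → ℝ} {x₂ : A₂ → ℝ}
    (h₁ : x₁ ∈ stdSimplex ℝ A₁) (h₂ : x₂ ∈ stdSimplex ℝ A₂) : 0 ≤ Γ.dualityGap x₁ x₂ := by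
  have hc := Γ.continuous_globalCost₁
  have b₁ : BddBelow (Set.range fun y : stdSimplex ℝ A₁ => Γ.globalCost₁ y x₂) := by
    have := (isCompact_stdSimplex ℝ A₁).bddBelow_image
      (f := fun y => Γ.globalCost₁ y x₂) (hc.comp (by fun_prop : Continuous
        fun y : A₁ → ℝ => (y, x₂))).continuousOn
    rwa [Set.image_eq_range] at this
  have b₂ : BddAbove (Set.range fun y : stdSimplex ℝ A₂ => Γ.globalCost₁ x₁ y) := by
    have := (isCompact_stdSimplex ℝ A₂).bddAbove_image
      (f := fun y => Γ.globalCost₁ x₁ y) (hc.comp (by fun_prop : Continuous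
        fun y : A₂ → ℝ => (x₁, y))).continuousOn
    rwa [Set.image_eq_range] at this
  exact sub_nonneg.2 ((ciInf_le b₁ ⟨x₁, h₁⟩).trans (le_ciSup b₂ ⟨x₂, h₂⟩))

theorem dualityGap_le [Nonempty A₁] [Nonempty A₂] (Γ : FiniteGame V₁ V₂ A₁ A₂) {x₁ : A₁ → ℝ}
    {x₂ : A₂ → ℝ} {E : ℝ} (h : ∀ y₁ ∈ stdSimplex ℝ A₁, ∀ y₂ ∈ stdSimplex ℝ A₂,
      Γ.globalCost₁ x₁ y₂ - Γ.globalCost₁ y₁ x₂ ≤ E) : Γ.dualityGap x₁ x₂ ≤ E := by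
  have n₁ : Nonempty (stdSimplex ℝ A₁) :=
    ⟨⟨_, pureStrategy_mem_stdSimplex (Classical.arbitrary A₁)⟩⟩
  have n₂ : Nonempty (stdSimplex ℝ A₂) :=
    ⟨⟨_, pureStrategy_mem_stdSimplex (Classical.arbitrary A₂)⟩⟩
  rw [dualityGap, sub_le_iff_le_add]
  refine ciSup_le fun y₂ => ?_
  rw [← sub_le_iff_le_add']
  exact le_ciInf fun y₁ => by linarith [h y₁ y₁.2 y₂ y₂.2]

/-- Approximate saddle points with vanishing error accumulate only at equilibria. -/
theorem exists_subseq_tendsto_mixedNash (Γ : FiniteGame V₁ V₂ A₁ A₂)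
    {z : ℕ → (A₁ → ℝ) × (A₂ → ℝ)} {E : ℕ → ℝ} (hE : Tendsto E atTop (𝓝 0))
    (hz : ∀ᶠ t in atTop, z t ∈ stdSimplex ℝ A₁ ×ˢ stdSimplex ℝ A₂)
    (h : ∀ᶠ t in atTop, ∀ y₁ ∈ stdSimplex ℝ A₁, ∀ y₂ ∈ stdSimplex ℝ A₂,
      Γ.globalCost₁ (z t).1 y₂ - Γ.globalCost₁ y₁ (z t).2 ≤ E t) :
    ∃ a ∈ Γ.mixedNash, ∃ φ : ℕ → ℕ, StrictMono φ ∧ Tendsto (z ∘ φ) atTop (𝓝 a) := by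
  obtain ⟨a, ha, φ, hφ, hlim⟩ := ((isCompact_stdSimplex ℝ A₁).prod
    (isCompact_stdSimplex ℝ A₂)).tendsto_subseq' hz.frequently
  obtain ⟨ha₁, ha₂⟩ := Set.mem_prod.1 ha
  refine ⟨a, Γ.mem_mixedNash_of_forall_le ha₁ ha₂ fun y₁ hy₁ y₂ hy₂ => ?_, φ, hφ, hlim⟩
  have l₁ : Tendsto (fun t => (z (φ t)).1) atTop (𝓝 a.1) := (continuous_fst.tendsto a).comp hlim
  have l₂ : Tendsto (fun t => (z (φ t)).2) atTop (𝓝 a.2) := (continuous_snd.tendsto a).comp hlim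
  have c₁ := Γ.tendsto_globalCost₁ l₁ (tendsto_const_nhds (x := y₂))
  have c₂ := Γ.tendsto_globalCost₁ (tendsto_const_nhds (x := y₁)) l₂
  have hE' : Tendsto (fun t => E (φ t)) atTop (𝓝 0) := hE.comp hφ.tendsto_atTop
  have hle : ∀ᶠ t in atTop,
      Γ.globalCost₁ (z (φ t)).1 y₂ - Γ.globalCost₁ y₁ (z (φ t)).2 ≤ E (φ t) :=
    (hφ.tendsto_atTop.eventually h).mono fun t ht => ht y₁ hy₁ y₂ hy₂
  exact sub_nonpos.1 (le_of_tendsto_of_tendsto (c₁.sub c₂) hE' hle)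

/-- Every subsequence is again a sequence of approximate saddle points, so it has a further
subsequence converging to an equilibrium, along which the distance vanishes. -/
theorem tendsto_infDist_mixedNash (Γ : FiniteGame V₁ V₂ A₁ A₂)
    {z : ℕ → (A₁ → ℝ) × (A₂ → ℝ)} {E : ℕ → ℝ} (hE : Tendsto E atTop (𝓝 0))
    (hz : ∀ᶠ t in atTop, z t ∈ stdSimplex ℝ A₁ ×ˢ stdSimplex ℝ A₂)
    (h : ∀ᶠ t in atTop, ∀ y₁ ∈ stdSimplex ℝ A₁, ∀ y₂ ∈ stdSimplex ℝ A₂,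
      Γ.globalCost₁ (z t).1 y₂ - Γ.globalCost₁ y₁ (z t).2 ≤ E t) :
    Tendsto (fun t => Metric.infDist (z t) Γ.mixedNash) atTop (𝓝 0) := by
  refine tendsto_of_subseq_tendsto fun ψ hψ => ?_
  obtain ⟨a, ha, φ, -, hlim⟩ := Γ.exists_subseq_tendsto_mixedNash (z := z ∘ ψ) (hE.comp hψ)
    (hψ.eventually hz) (hψ.eventually h)
  refine ⟨φ, ?_⟩
  rw [← Metric.infDist_zero_of_mem ha]
  exact ((Metric.continuous_infDist_pt _).tendsto a).comp hlim

end FiniteGame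

/-! ### The algorithm as two coupled instances of `MWDynamics`. -/

section Iterates

variable {V₁ V₂ A₁ A₂ : Type*} [Fintype V₁] [Fintype V₂]

/-- Weights vanish off the edges. The map `f` lets one statement serve both the inner graphs (`id`)
and the cross graph (`Sum.inl`, `Sum.inr`). -/
theorem WeightsCompatible.sum_neighbors_eq {V U A : Type*} [Fintype U] {η : ℝ} {G : Digraph V}
    {W : Matrix V V ℝ} (h : WeightsCompatible η G W) (i : V) (f : U → V) (x : U → A → ℝ) :
    ∑ j with G.Adj (f j) i, W i (f j) • x j = ∑ j, W i (f j) • x j := by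
  refine Finset.sum_filter_of_ne fun j _ hj => ?_
  by_contra hadj
  exact hj (by rw [(h i (f j)).2 hadj, zero_smul])

variable {N : Network V₁ V₂}

theorem Network.Admissible.avg₁_eq (hN : N.Admissible) (t : ℕ) (x : Estimates V₁ V₂ A₁ A₂)
    (i : V₁) : avg₁ N t x i = ∑ j, N.weight₁ t i j • x.1 j := by
  obtain ⟨η, -, -, h⟩ := hN.weights
  exact (h t).1.sum_neighbors_eq i id x.1

theorem Network.Admissible.avg₂_eq (hN : N.Admissible) (t : ℕ) (x : Estimates V₁ V₂ A₁ A₂)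
    (i : V₂) : avg₂ N t x i = ∑ j, N.weight₂ t i j • x.2 j := by
  obtain ⟨η, -, -, h⟩ := hN.weights
  exact (h t).2.1.sum_neighbors_eq i id x.2

theorem Network.Admissible.cross₂_eq (hN : N.Admissible) (t : ℕ) (x : Estimates V₁ V₂ A₁ A₂)
    (i : V₁) : cross₂ N t x i = ∑ j, N.weight₁₂ t (Sum.inl i) (Sum.inr j) • x.2 j := by
  obtain ⟨η, -, -, h⟩ := hN.weights
  exact (h t).2.2.sum_neighbors_eq (Sum.inl i) Sum.inr x.2

theorem Network.Admissible.cross₁_eq (hN : N.Admissible) (t : ℕ) (x : Estimates V₁ V₂ A₁ A₂)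
    (i : V₂) : cross₁ N t x i = ∑ j, N.weight₁₂ t (Sum.inr i) (Sum.inl j) • x.1 j := by
  obtain ⟨η, -, -, h⟩ := hN.weights
  exact (h t).2.2.sum_neighbors_eq (Sum.inr i) Sum.inl x.1

theorem Network.Admissible.weight₁_nonneg (hN : N.Admissible) (t : ℕ) (i j : V₁) :
    0 ≤ N.weight₁ t i j := by
  obtain ⟨η, hη, -, h⟩ := hN.weights
  exact (h t).1.nonneg hη i j

theorem Network.Admissible.weight₂_nonneg (hN : N.Admissible) (t : ℕ) (i j : V₂) :
    0 ≤ N.weight₂ t i j := by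
  obtain ⟨η, hη, -, h⟩ := hN.weights
  exact (h t).2.1.nonneg hη i j

theorem Network.Admissible.weight₁₂_nonneg (hN : N.Admissible) (t : ℕ) (i j : V₁ ⊕ V₂) :
    0 ≤ N.weight₁₂ t i j := by
  obtain ⟨η, hη, -, h⟩ := hN.weights
  exact (h t).2.2.nonneg hη i j

variable [Fintype A₁] [Fintype A₂] [Nonempty A₁] [Nonempty A₂] (Γ : FiniteGame V₁ V₂ A₁ A₂) (α : ℕ → ℝ)

theorem mwIterates_mem_openSimplex (hN : N.Admissible) (t : ℕ) :
    (∀ i, (mwIterates Γ N α t).1 i ∈ openSimplex A₁) ∧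
      ∀ j, (mwIterates Γ N α t).2 j ∈ openSimplex A₂ := by
  induction t with
  | zero => exact ⟨fun _ => uniform_mem_openSimplex, fun _ => uniform_mem_openSimplex⟩
  | succ t ih =>
    refine ⟨fun i => mwUpdate_mem_openSimplex ?_, fun j => mwUpdate_mem_openSimplex ?_⟩
    · rw [hN.avg₁_eq]
      exact weightedSum_mem_openSimplex (hN.weight₁_nonneg t i) (hN.rowSum₁ t i) ih.1
    · rw [hN.avg₂_eq]
      exact weightedSum_mem_openSimplex (hN.weight₂_nonneg t j) (hN.rowSum₂ t j) ih.2

variable {α}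

theorem mwDynamics_fst (hN : N.Admissible) (hα : ∀ t, 0 ≤ α t) (hα0 : Tendsto α atTop (𝓝 0)) :
    MWDynamics Γ.cost₁ α N.graph₁ N.weight₁ (fun t => (mwIterates Γ N α t).1)
      (fun t i => cross₂ N t (mwIterates Γ N α t) i) where
  connected := hN.connected₁
  self := hN.self₁
  weights := by
    obtain ⟨η, h0, h1, h⟩ := hN.weights
    exact ⟨η, h0, h1, fun k => (h k).1⟩
  rowSum := hN.rowSum₁
  colSum := hN.colSum₁
  step_nonneg := hα
  step_tendsto := hα0
  opponent_mem t i := by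
    rw [hN.cross₂_eq]
    exact openSimplex_subset_stdSimplex (weightedSum_mem_openSimplex
      (fun j => hN.weight₁₂_nonneg t _ _) (hN.crossSum₁ t i) (mwIterates_mem_openSimplex Γ α hN t).2)
  mem t := (mwIterates_mem_openSimplex Γ α hN t).1
  init _ := rfl
  update t i := by
    rw [← hN.avg₁_eq]
    rfl

/-- The second subnetwork also minimizes its own cost, so it fits the same structure after
transposing the arguments. -/
theorem mwDynamics_snd (hN : N.Admissible) (hα : ∀ t, 0 ≤ α t) (hα0 : Tendsto α atTop (𝓝 0)) :
    MWDynamics (fun j q p => Γ.cost₂ j p q) α N.graph₂ N.weight₂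
      (fun t => (mwIterates Γ N α t).2) (fun t i => cross₁ N t (mwIterates Γ N α t) i) where
  connected := hN.connected₂
  self := hN.self₂
  weights := by
    obtain ⟨η, h0, h1, h⟩ := hN.weights
    exact ⟨η, h0, h1, fun k => (h k).2.1⟩
  rowSum := hN.rowSum₂
  colSum := hN.colSum₂
  step_nonneg := hα
  step_tendsto := hα0
  opponent_mem t i := by
    rw [hN.cross₁_eq]
    exact openSimplex_subset_stdSimplex (weightedSum_mem_openSimplex
      (fun j => hN.weight₁₂_nonneg t _ _) (hN.crossSum₂ t i) (mwIterates_mem_openSimplex Γ α hN t).1)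
  mem t := (mwIterates_mem_openSimplex Γ α hN t).2
  init _ := rfl
  update t i := by
    simp only [expCost_swap]
    rw [← hN.avg₂_eq]
    rfl

/-- The averaged iterates are approximate saddle points with vanishing error. -/
theorem exists_saddle_error [Nonempty V₁] [Nonempty V₂] (hΓ : Γ.IsZeroSum) (hN : N.Admissible)
    (hα : ∀ t, 0 ≤ α t) (hα0 : Tendsto α atTop (𝓝 0))
    (hsum : Tendsto (fun t => ∑ s ∈ Finset.range t, α s) atTop atTop) (i : V₁) (j : V₂) :
    ∃ E : ℕ → ℝ, Tendsto E atTop (𝓝 0) ∧ ∀ t, ∀ y₁ ∈ stdSimplex ℝ A₁, ∀ y₂ ∈ stdSimplex ℝ A₂,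
      Γ.globalCost₁ (ergodicAverage α (fun s => (mwIterates Γ N α s).1 i) t) y₂ -
        Γ.globalCost₁ y₁ (ergodicAverage α (fun s => (mwIterates Γ N α s).2 j) t) ≤ E t := by
  have d₁ := mwDynamics_fst Γ hN hα hα0
  have d₂ := mwDynamics_snd Γ hN hα hα0
  set x₁ : ℕ → A₁ → ℝ := fun s => (mwIterates Γ N α s).1 i with hx₁
  set x₂ : ℕ → A₂ → ℝ := fun s => (mwIterates Γ N α s).2 j with hx₂
  have m₁ : ∀ s, x₁ s ∈ stdSimplex ℝ A₁ := fun s => openSimplex_subset_stdSimplex (d₁.mem s i)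
  have m₂ : ∀ s, x₂ s ∈ stdSimplex ℝ A₂ := fun s => openSimplex_subset_stdSimplex (d₂.mem s j)
  -- The opponent's reference trajectory is that of the single agent `j`; consensus in the other
  -- subnetwork makes every cross estimate asymptotically equal to it.
  obtain ⟨K₁, e₁, he₁, h₁⟩ := d₁.regret i m₂ fun k => by
    refine squeeze_zero (fun t => l1Dist_nonneg _ _) (fun t => ?_)
      (by simpa using tendsto_finsetSum Finset.univ fun k _ => d₂.tendsto_l1Dist k j)
    rw [hN.cross₂_eq]
    exact l1Dist_weightedSum_le (fun j => hN.weight₁₂_nonneg t _ _) (hN.crossSum₁ t k) _ _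
  obtain ⟨K₂, e₂, he₂, h₂⟩ := d₂.regret j m₁ fun k => by
    refine squeeze_zero (fun t => l1Dist_nonneg _ _) (fun t => ?_)
      (by simpa using tendsto_finsetSum Finset.univ fun k _ => d₁.tendsto_l1Dist k i)
    rw [hN.cross₁_eq]
    exact l1Dist_weightedSum_le (fun j => hN.weight₁₂_nonneg t _ _) (hN.crossSum₂ t k) _ _
  set n₁ : ℝ := 1 / (Fintype.card V₁ : ℝ) with hn₁
  set n₂ : ℝ := 1 / (Fintype.card V₂ : ℝ) with hn₂
  have p₁ : 0 ≤ n₁ := by positivity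
  have p₂ : 0 ≤ n₂ := by positivity
  set S : ℕ → ℝ := fun t => ∑ s ∈ Finset.range t, α s with hS
  have hS0 : ∀ t, 0 ≤ 1 / S t := fun t =>
    one_div_nonneg.2 (Finset.sum_nonneg fun s _ => hα s)
  -- The regret bounds concern sums over agents, hence the factors `n₁` and `n₂`. At `t = 0` the
  -- convention `1 / 0 = 0` makes both sides of the estimate zero.
  refine ⟨fun t => 1 / S t * (n₁ * K₁ + n₂ * K₂) +
    1 / S t * ∑ s ∈ Finset.range t, α s * (n₁ * e₁ s + n₂ * e₂ s), ?_, fun t y₁ hy₁ y₂ hy₂ => ?_⟩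
  · have l₁ : Tendsto (fun t => 1 / S t * (n₁ * K₁ + n₂ * K₂)) atTop (𝓝 0) := by
      simpa using (hsum.inv_tendsto_atTop).mul_const (n₁ * K₁ + n₂ * K₂)
    have l₂ := tendsto_weighted_average hα hsum
      (by simpa using (he₁.const_mul n₁).add (he₂.const_mul n₂))
    simpa using l₁.add l₂
  · rw [Γ.globalCost₁_eq_expCost, Γ.globalCost₁_eq_expCost, expCost_ergodicAverage_left,
      expCost_ergodicAverage_right]
    simp only [← Γ.globalCost₁_eq_expCost]
    rw [← mul_sub, ← mul_add]
    refine mul_le_mul_of_nonneg_left ?_ (hS0 t)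
    have r₁ := mul_le_mul_of_nonneg_left (h₁ y₁ hy₁ t) p₁
    have r₂ := mul_le_mul_of_nonneg_left (h₂ y₂ hy₂ t) p₂
    simp only [expCost_swap] at r₂
    have q₁ : ∀ s, n₁ * (α s * (∑ k, expCost (Γ.cost₁ k) (x₁ s) (x₂ s) -
        ∑ k, expCost (Γ.cost₁ k) y₁ (x₂ s))) =
        α s * Γ.globalCost₁ (x₁ s) (x₂ s) - α s * Γ.globalCost₁ y₁ (x₂ s) := fun s => by
      simp only [FiniteGame.globalCost₁, ← hn₁]; ring
    -- The zero-sum condition turns the second cost into the negative of the first, so the terms at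
    -- `(x₁ s, x₂ s)` cancel when `r₁` and `r₂` are added.
    have q₂ : ∀ s, n₂ * (α s * (∑ k, expCost (Γ.cost₂ k) (x₁ s) (x₂ s) -
        ∑ k, expCost (Γ.cost₂ k) (x₁ s) y₂)) =
        α s * Γ.globalCost₁ (x₁ s) y₂ - α s * Γ.globalCost₁ (x₁ s) (x₂ s) := fun s => by
      rw [eq_neg_of_add_eq_zero_left (hΓ _ (m₁ s) _ (m₂ s)),
        eq_neg_of_add_eq_zero_left (hΓ _ (m₁ s) _ hy₂)]
      simp only [FiniteGame.globalCost₂, ← hn₂]; ring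
    rw [Finset.mul_sum (Finset.range t) _ n₁, Finset.sum_congr rfl fun s _ => q₁ s,
      Finset.sum_sub_distrib, mul_add] at r₁
    rw [Finset.mul_sum (Finset.range t) _ n₂, Finset.sum_congr rfl fun s _ => q₂ s,
      Finset.sum_sub_distrib, mul_add] at r₂
    have e : ∑ s ∈ Finset.range t, α s * (n₁ * e₁ s + n₂ * e₂ s) =
        n₁ * ∑ s ∈ Finset.range t, α s * e₁ s + n₂ * ∑ s ∈ Finset.range t, α s * e₂ s := by
      rw [Finset.mul_sum, Finset.mul_sum, ← Finset.sum_add_distrib]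
      exact Finset.sum_congr rfl fun s _ => by ring
    rw [e]
    linarith

end Iterates

end SubnetworkGame

/-! ### Conclusion. -/

theorem theorem5 {V₁ V₂ A₁ A₂ : Type*} [Fintype V₁] [Fintype V₂] [Fintype A₁] [Fintype A₂]
    [Nonempty V₁] [Nonempty V₂] [Nonempty A₁] [Nonempty A₂]
    (Γ : SubnetworkGame.FiniteGame V₁ V₂ A₁ A₂) (hΓ : Γ.IsZeroSum)
    (N : SubnetworkGame.Network V₁ V₂) (hN : N.Admissible)
    (α : ℕ → ℝ) (hpos : ∀ t, 0 < α t) (hanti : Antitone α)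
    (hsum : Tendsto (fun t => ∑ s ∈ Finset.range t, α s) atTop atTop)
    (hsq : Summable fun t => α t ^ 2) :
    Γ.mixedNash.Nonempty ∧
    ∀ (i : V₁) (j : V₂),
      Tendsto (fun t => Γ.dualityGap
          (SubnetworkGame.ergodicAverage α
            (fun s => (SubnetworkGame.mwIterates Γ N α s).1 i) t)
          (SubnetworkGame.ergodicAverage α
            (fun s => (SubnetworkGame.mwIterates Γ N α s).2 j) t)) atTop (𝓝 0) ∧
      Tendsto (fun t => Metric.infDist
          (SubnetworkGame.ergodicAverage α
            (fun s => (SubnetworkGame.mwIterates Γ N α s).1 i) t,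
           SubnetworkGame.ergodicAverage α
            (fun s => (SubnetworkGame.mwIterates Γ N α s).2 j) t) Γ.mixedNash) atTop (𝓝 0) := by
  have hα : ∀ t, 0 ≤ α t := fun t => (hpos t).le
  -- Square summability enters here: `α t ^ 2` tends to zero, hence so does its square root `α t`.
  have hα0 : Tendsto α atTop (𝓝 0) := by
    have h := (Real.continuous_sqrt.tendsto 0).comp hsq.tendsto_atTop_zero
    simpa [Function.comp_def, Real.sqrt_sq (hα _)] using h
  have hmem : ∀ (i : V₁) (j : V₂), ∀ᶠ t in atTop,
      (SubnetworkGame.ergodicAverage α (fun s => (SubnetworkGame.mwIterates Γ N α s).1 i) t,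
       SubnetworkGame.ergodicAverage α (fun s => (SubnetworkGame.mwIterates Γ N α s).2 j) t) ∈
      stdSimplex ℝ A₁ ×ˢ stdSimplex ℝ A₂ := by
    intro i j
    -- The empty average at `t = 0` is the zero vector, not a strategy, so membership is only
    -- claimed eventually.
    filter_upwards [hsum.eventually_gt_atTop 0] with t ht
    have h := SubnetworkGame.mwIterates_mem_openSimplex Γ α hN
    exact ⟨SubnetworkGame.ergodicAverage_mem_stdSimplex hα (fun s =>
        SubnetworkGame.openSimplex_subset_stdSimplex ((h s).1 i)) ht,
      SubnetworkGame.ergodicAverage_mem_stdSimplex hα (fun s =>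
        SubnetworkGame.openSimplex_subset_stdSimplex ((h s).2 j)) ht⟩
  have hgap := SubnetworkGame.exists_saddle_error Γ hΓ hN hα hα0 hsum
  refine ⟨?_, fun i j => ?_⟩
  -- An equilibrium is obtained as an accumulation point of the algorithm's own averages.
  · obtain ⟨E, hE, h⟩ := hgap (Classical.arbitrary V₁) (Classical.arbitrary V₂)
    obtain ⟨a, ha, -⟩ := Γ.exists_subseq_tendsto_mixedNash hE (hmem _ _) (Eventually.of_forall h)
    exact ⟨a, ha⟩
  · obtain ⟨E, hE, h⟩ := hgap i j
    refine ⟨?_, Γ.tendsto_infDist_mixedNash hE (hmem i j) (Eventually.of_forall h)⟩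
    refine squeeze_zero' ?_ (Eventually.of_forall fun t => Γ.dualityGap_le (h t)) hE
    filter_upwards [hmem i j] with t ht using Γ.dualityGap_nonneg ht.1 ht.2
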